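/- Let $n,k\ge 1$ be integers and let $0\le\eta\le 1$. For a cost function $H:\{+1,-1\}^n\to\mathbb{R}$ write $E^*=\min_z H(z)$ and, for $E\in\mathbb{R}$, $C(E)=|\{z\in\{+1,-1\}^n : H(z)\le E\}|$. (1) Let $H=\sum_{j=1}^m \mathcal{C}_j$ ($m\ge1$) be a MAX-$k$-CSP instance: each constraint $\mathcal{C}_j$ is a function of at most $k$ of the $n$ bits of $z$; regarded as a function of $k$ bits (adding dummy bits if there are fewer), it takes the value $-1$ on $s_j$ of the $2^k$ settings of these bits and the value $s_j/(2^k-s_j)$ on the other $2^k-s_j$ settings, where $0\le s_j<2^k$. If each of the $n$ variables participates in at most $2km/n$ of the $m$ constraints, then $$C\big((1-\eta)E^*\big)\le 2^{(1-\gamma)n},\qquad \gamma=\left(\frac{|E^*|}{m}\right)^2\frac{(1-\eta)^2}{2\ln(2)\,2^{2k}k^2}.$$ (2) Let $H$ be drawn from the $k$-spin model $$H(z)=\sqrt{\frac{k!}{n^{k-1}}}\sum_{1\le i_1<\dots<i_k\le n}J_{i_1,\dots,i_k}\,z_{i_1}\cdots z_{i_k},$$ where the coefficients $J_{i_1,\dots,i_k}$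 are independent standard Gaussian random variables. Then, with $$\gamma=\frac{(1-\eta)^2}{32\pi\ln(2)\,k^2},$$ with probability at least $1-2^{-\gamma n+1}$ over the choice of $H$, $$C\big((1-\eta)E^*\big)\le 2^{(1-\gamma)n}.$$ -/

import Mathlib

noncomputable section

namespace TailBound

/-- Assignments `z ∈ {+1,-1}^n`. -/
abbrev Assignment (n : ℕ) : Type := Fin n → ℤˣ

/-- The optimal value `E^* = min_z H(z)` of a cost function. -/
def optValue {n : ℕ} (H : Assignment n → ℝ) : ℝ :=
  Finset.univ.inf' Finset.univ_nonempty H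

/-- `C(E)`, the number of assignments `z` with `H(z) ≤ E`. -/
def countBelow {n : ℕ} (H : Assignment n → ℝ) (E : ℝ) : ℕ :=
  (Finset.univ.filter fun z : Assignment n => H z ≤ E).card

/-- A `k`-constraint on `n` bits: a set of at most `k` participating bits, together with the
set of satisfying settings of those bits, which is not the set of all settings. -/
structure Constraint (n k : ℕ) where
  /-- the participating bits -/
  vars : Finset (Fin n)
  card_vars_le : vars.card ≤ k
  /-- the satisfying settings of the participating bits -/
  sat : Finset (vars → ℤˣ)
  sat_ne_univ : sat ≠ Finset.univ

/-- The number `s` of satisfying settings out of `2^k`: if fewer than `k` bits participate, each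
satisfying setting of them is counted once for every setting of the missing `k - |vars|` bits. -/
def Constraint.numSat {n k : ℕ} (c : Constraint n k) : ℕ :=
  2 ^ (k - c.vars.card) * c.sat.card

/-- The value of a constraint: `-1` if satisfied and `s / (2^k - s)` otherwise. -/
def Constraint.value {n k : ℕ} (c : Constraint n k) (z : Assignment n) : ℝ :=
  if (fun i : c.vars => z i) ∈ c.sat then -1 else (c.numSat : ℝ) / ((2 : ℝ) ^ k - c.numSat)

/-- The cost function `H = ∑_j C_j` of a MAX-`k`-CSP instance with `m` constraints. -/
def cspCost {n k m : ℕ} (c : Fin m → Constraint n k) (z : Assignment n) : ℝ :=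
  ∑ j, (c j).value z

/-- The number `d_i` of constraints in which the bit `i` participates. -/
def cspDegree {n k m : ℕ} (c : Fin m → Constraint n k) (i : Fin n) : ℕ :=
  (Finset.univ.filter fun j : Fin m => i ∈ (c j).vars).card

/-- Couplings of the `k`-spin model: one real number for each `k`-element set of spins, that is,
for each `i_1 < ... < i_k`. -/
abbrev Couplings (n k : ℕ) : Type := {S : Finset (Fin n) // S.card = k} → ℝ

/-- `H(z) = sqrt (k! / n^(k-1)) * ∑_{i_1 < ... < i_k} J_{i_1,...,i_k} z_{i_1} ... z_{i_k}`. -/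
def kSpinCost {n k : ℕ} (J : Couplings n k) (z : Assignment n) : ℝ :=
  Real.sqrt ((k.factorial : ℝ) / (n : ℝ) ^ (k - 1)) *
    ∑ S : {S : Finset (Fin n) // S.card = k}, J S * ∏ i ∈ S.1, ((z i : ℤ) : ℝ)

/-- The `k`-spin ensemble: all couplings are independent standard Gaussians. -/
def kSpinLaw (n k : ℕ) : MeasureTheory.Measure (Couplings n k) :=
  MeasureTheory.Measure.pi fun _ => ProbabilityTheory.gaussianReal 0 1

/-- The exponent `γ` for a MAX-`k`-CSP instance with `m` constraints and optimal value `E`. -/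
def cspGamma (k m : ℕ) (E η : ℝ) : ℝ :=
  (|E| / m) ^ 2 * ((1 - η) ^ 2 / (2 * Real.log 2 * 2 ^ (2 * k) * k ^ 2))

/-- The exponent `γ` for the `k`-spin model. -/
def kSpinGamma (k : ℕ) (η : ℝ) : ℝ :=
  (1 - η) ^ 2 / (32 * Real.pi * Real.log 2 * k ^ 2)

end TailBound

end

/-!
For the constraint satisfaction instances, flipping the bit `i` changes `H` by at most `2^k` times
the number of constraints in which `i` participates, and `H` has mean `0` over the uniform measure
on the cube because each constraint does. McDiarmid's inequality therefore bounds the fraction of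
assignments with `H z ≤ (1 - η) E^*`.

In the `k`-spin model, choose the spins one after the other, each with the sign that lowers the
energy. At the step of spin `i` the couplings of `i` with earlier spins are still fresh, so the
energy drops by `|N|` for a Gaussian `N` that is independent of the choices made so far. This bounds
`E[exp (l E^*)]`, and hence the probability that `E^*` exceeds `-G / 2`, where `G` is a lower bound
for the expected total drop. On the other hand `H z` is, for every fixed `z`, a centred Gaussian of
variance at most `n`, so by Markov's inequality few assignments reach `-(1 - η) G / 2`. With the
stated `γ` each of the two failure probabilities is at most `2^(-γ n)`. The estimate of `G` needs
`2 k^2 ≤ n`, but the claim is vacuous unless `γ n > 1`, which is stronger.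
-/

noncomputable section

namespace TailBound

open MeasureTheory ProbabilityTheory
open scoped NNReal ENNReal

section McDiarmid

/-- The hypothesis of McDiarmid's inequality: `f` changes by at most `c i` when only the `i`-th
coordinate of its argument changes. -/
def HasBoundedDifferences {ι : Type*} [DecidableEq ι] {Ω : ι → Type*} (f : (∀ i, Ω i) → ℝ)
    (c : ι → ℝ) : Prop :=
  ∀ i x a, |f (Function.update x i a) - f x| ≤ c i

theorem hasSubgaussianMGF_sub_integral_of_abs_sub_le {Ω : Type*} [MeasurableSpace Ω]
    {μ : Measure Ω} [IsProbabilityMeasure μ] {X : Ω → ℝ} {c : ℝ} (hX : Measurable X)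
    (hc : ∀ ω ω', |X ω - X ω'| ≤ c) :
    HasSubgaussianMGF (fun ω => X ω - μ[X]) ((‖c‖₊ / 2) ^ 2) μ := by
  have : Nonempty Ω := μ.nonempty_of_neZero
  have hsub : ∀ ω ω', X ω - c ≤ X ω' := fun ω ω' => by linarith [(abs_le.1 (hc ω ω')).2]
  have hbdd : BddBelow (Set.range X) :=
    ⟨X (Classical.arbitrary Ω) - c, Set.forall_mem_range.2 (hsub _)⟩
  have h := hasSubgaussianMGF_of_mem_Icc (μ := μ) (a := ⨅ ω, X ω) (b := (⨅ ω, X ω) + c)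
    hX.aemeasurable (ae_of_all _ fun ω =>
      ⟨ciInf_le hbdd ω, by linarith [le_ciInf (hsub ω)]⟩)
  rwa [add_sub_cancel_left] at h

theorem hasSubgaussianMGF_prod_of_section {α β : Type*} [MeasurableSpace α] [MeasurableSpace β]
    {μ : Measure α} {ν : Measure β} [SFinite μ] [SFinite ν] {f : α × β → ℝ} {g : β → ℝ}
    {c d : ℝ≥0} (hf : Measurable f)
    (hfg : ∀ b, HasSubgaussianMGF (fun a => f (a, b) - g b) c μ) (hg : HasSubgaussianMGF g d ν) :
    HasSubgaussianMGF f (c + d) (μ.prod ν) := by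
  have hfactor (t : ℝ) (a : α) (b : β) :
      Real.exp (t * f (a, b)) = Real.exp (t * (f (a, b) - g b)) * Real.exp (t * g b) := by
    rw [← Real.exp_add, ← mul_add, sub_add_cancel]
  have hmeas (t : ℝ) : Measurable fun p => Real.exp (t * f p) := by fun_prop
  have hsection (t : ℝ) (b : β) :
      ∫ a, Real.exp (t * f (a, b)) ∂μ ≤ Real.exp (c * t ^ 2 / 2) * Real.exp (t * g b) := by
    simp_rw [hfactor t _ b, integral_mul_const]
    exact mul_le_mul_of_nonneg_right ((hfg b).mgf_le t) (Real.exp_pos _).le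
  have hbound (t : ℝ) := (hg.integrable_exp_mul t).const_mul (Real.exp (c * t ^ 2 / 2))
  have hint (t : ℝ) : Integrable (fun p => Real.exp (t * f p)) (μ.prod ν) := by
    refine (integrable_prod_iff' (hmeas t).aestronglyMeasurable).2 ⟨ae_of_all _ fun b => ?_, ?_⟩
    · simp_rw [hfactor t _ b]
      exact ((hfg b).integrable_exp_mul t).mul_const _
    · simp only [Real.norm_of_nonneg (Real.exp_pos _).le]
      refine (hbound t).mono' (hmeas t).stronglyMeasurable.integral_prod_left'.aestronglyMeasurable
        (ae_of_all _ fun b => ?_)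
      rw [Real.norm_of_nonneg (integral_nonneg fun a => (Real.exp_pos _).le)]
      exact hsection t b
  refine ⟨hint, fun t => ?_⟩
  calc mgf f (μ.prod ν) t = ∫ b, ∫ a, Real.exp (t * f (a, b)) ∂μ ∂ν :=
        integral_prod_symm _ (hint t)
    _ ≤ ∫ b, Real.exp (c * t ^ 2 / 2) * Real.exp (t * g b) ∂ν :=
        integral_mono (hint t).integral_prod_right (hbound t) (hsection t)
    _ = Real.exp (c * t ^ 2 / 2) * mgf g ν t := integral_const_mul _ _
    _ ≤ Real.exp (c * t ^ 2 / 2) * Real.exp (d * t ^ 2 / 2) := by gcongr; exact hg.mgf_le t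
    _ = Real.exp ((c + d : ℝ≥0) * t ^ 2 / 2) := by
        rw [← Real.exp_add, NNReal.coe_add]
        ring_nf

theorem hasSubgaussianMGF_sub_integral_prod {α β : Type*} [MeasurableSpace α] [MeasurableSpace β]
    {μ : Measure α} {ν : Measure β} [IsFiniteMeasure μ] [IsFiniteMeasure ν] {f : α × β → ℝ}
    {c d : ℝ≥0}
    (hf : Measurable f)
    (hsection : ∀ b, HasSubgaussianMGF (fun a => f (a, b) - ∫ a', f (a', b) ∂μ) c μ)
    (hmarginal : HasSubgaussianMGF
      (fun b => ∫ a, f (a, b) ∂μ - ∫ b', ∫ a, f (a, b') ∂μ ∂ν) d ν) :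
    HasSubgaussianMGF (fun p => f p - (μ.prod ν)[f]) (c + d) (μ.prod ν) := by
  set m := ∫ b', ∫ a, f (a, b') ∂μ ∂ν
  have hsub : HasSubgaussianMGF (fun p => f p - m) (c + d) (μ.prod ν) :=
    hasSubgaussianMGF_prod_of_section (hf.sub_const m)
      (fun b => by simpa only [sub_sub_sub_cancel_right] using hsection b) hmarginal
  have hint : Integrable f (μ.prod ν) := by
    simpa only [Pi.add_def, sub_add_cancel] using hsub.integrable.add (integrable_const m)
  rwa [integral_prod_symm f hint]

theorem HasBoundedDifferences.integral {α ι : Type*} [DecidableEq ι] {Ω : ι → Type*}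
    [MeasurableSpace α] {μ : Measure α} [IsProbabilityMeasure μ] {F : α → (∀ i, Ω i) → ℝ}
    {c : ι → ℝ} (hF : ∀ a, HasBoundedDifferences (F a) c)
    (hint : ∀ x, Integrable (fun a => F a x) μ) :
    HasBoundedDifferences (fun x => ∫ a, F a x ∂μ) c := fun i x b => by
  rw [← integral_sub (hint _) (hint _)]
  simpa using norm_integral_le_of_norm_le_const (μ := μ)
    (f := fun a => F a (Function.update x i b) - F a x) (ae_of_all _ fun a => hF a i x b)

theorem HasBoundedDifferences.comp_insertNth {n : ℕ} {Ω : Fin (n + 1) → Type*}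
    {f : (∀ i, Ω i) → ℝ} {c : Fin (n + 1) → ℝ} (hf : HasBoundedDifferences f c) (i : Fin (n + 1))
    (a : Ω i) :
    HasBoundedDifferences (fun y => f (i.insertNth a y)) fun j => c (i.succAbove j) :=
  fun j y b => by
    simpa only [Fin.insertNth_update] using hf (i.succAbove j) (i.insertNth a y) b

theorem HasBoundedDifferences.hasSubgaussianMGF_sub_integral {n : ℕ} {Ω : Fin n → Type*}
    [∀ i, MeasurableSpace (Ω i)] (μ : ∀ i, Measure (Ω i)) [∀ i, IsProbabilityMeasure (μ i)]
    {f : (∀ i, Ω i) → ℝ} {c : Fin n → ℝ} (hfc : HasBoundedDifferences f c) (hf : Measurable f) :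
    HasSubgaussianMGF (fun x => f x - (Measure.pi μ)[f]) (∑ i, (‖c i‖₊ / 2) ^ 2)
      (Measure.pi μ) := by
  induction n with
  | zero => simp [Subsingleton.elim _ (default : ∀ i, Ω i)]
  | succ n ih =>
    have he := measurePreserving_piFinSuccAbove μ 0
    set F : Ω 0 × (∀ j, Ω (Fin.succAbove 0 j)) → ℝ := fun p => f (Fin.insertNth 0 p.1 p.2)
    have hF : Measurable F := hf.comp (MeasurableEquiv.piFinSuccAbove Ω 0).symm.measurable
    have hfF : f = F ∘ MeasurableEquiv.piFinSuccAbove Ω 0 :=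
      funext fun x => congrArg f ((MeasurableEquiv.piFinSuccAbove Ω 0).symm_apply_apply x).symm
    have hsection (y) : HasSubgaussianMGF (fun a => F (a, y) - ∫ a', F (a', y) ∂(μ 0))
        ((‖c 0‖₊ / 2) ^ 2) (μ 0) := by
      refine hasSubgaussianMGF_sub_integral_of_abs_sub_le (by fun_prop) fun a b => ?_
      simpa only [Fin.update_insertNth] using hfc 0 (Fin.insertNth 0 b y) a
    have hint (y) : Integrable (fun a => F (a, y)) (μ 0) := by
      simpa only [Pi.add_def, sub_add_cancel] using
        (hsection y).integrable.add (integrable_const (∫ a, F (a, y) ∂(μ 0)))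
    have hmarginal := ih (fun j => μ (Fin.succAbove 0 j))
      (HasBoundedDifferences.integral (fun a => hfc.comp_insertNth 0 a) hint)
      hF.stronglyMeasurable.integral_prod_left'.measurable
    have hprod := hasSubgaussianMGF_sub_integral_prod hF hsection hmarginal
    rw [← he.map_eq, integral_map he.measurable.aemeasurable hF.aestronglyMeasurable] at hprod
    rw [Fin.sum_univ_succAbove _ 0, hfF]
    exact hprod.of_map he.measurable.aemeasurable

theorem HasBoundedDifferences.measureReal_le_integral_sub_le {n : ℕ} {Ω : Fin n → Type*}
    [∀ i, MeasurableSpace (Ω i)] (μ : ∀ i, Measure (Ω i)) [∀ i, IsProbabilityMeasure (μ i)]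
    {f : (∀ i, Ω i) → ℝ} {c : Fin n → ℝ} (hfc : HasBoundedDifferences f c) (hf : Measurable f)
    {s : ℝ} (hs : 0 ≤ s) :
    (Measure.pi μ).real {x | f x ≤ (Measure.pi μ)[f] - s} ≤
      Real.exp (-(2 * s ^ 2 / ∑ i, c i ^ 2)) := by
  have h := (hfc.hasSubgaussianMGF_sub_integral μ hf).neg.measure_ge_le hs
  convert h using 2
  · ext x
    simp only [Set.mem_ofPred_eq, Pi.neg_apply]
    constructor <;> intro <;> linarith
  · push_cast
    simp only [div_pow, ← Finset.sum_div, Real.norm_eq_abs, sq_abs]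
    field_simp

end McDiarmid

section Cube

instance : MeasurableSingletonClass ℤˣ :=
  ⟨fun u => ⟨{(u : ℤ)}, measurableSet_singleton _, by ext v; simp [Units.ext_iff]⟩⟩

theorem optValue_le {n : ℕ} (H : Assignment n → ℝ) (z : Assignment n) : optValue H ≤ H z :=
  Finset.inf'_le _ (Finset.mem_univ z)

theorem exists_eq_optValue (H : Assignment n → ℝ) : ∃ z, H z = optValue H := by
  obtain ⟨z, -, hz⟩ := Finset.exists_mem_eq_inf' Finset.univ_nonempty H
  exact ⟨z, hz.symm⟩

theorem optValue_const_mul {c : ℝ} (hc : 0 ≤ c) (H : Assignment n → ℝ) :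
    optValue (fun z => c * H z) = c * optValue H :=
  (map_finset_inf' (OrderHom.mk (c * ·) (monotone_mul_left_of_nonneg hc)) _ H).symm

theorem measurable_optValue {Ω : Type*} [MeasurableSpace Ω] {H : Ω → Assignment n → ℝ}
    (hH : ∀ z, Measurable fun x => H x z) : Measurable fun x => optValue (H x) := by
  simp only [optValue, Finset.inf'_univ_eq_ciInf]
  exact Measurable.iInf hH

theorem countBelow_mono (H : Assignment n → ℝ) : Monotone (countBelow H) := fun _ _ hEF =>
  Finset.card_le_card (Finset.monotone_filter_right _ fun _ _ hz => hz.trans hEF)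

theorem integral_uniformOn_univ {Ω : Type*} [Fintype Ω] [MeasurableSpace Ω]
    [MeasurableSingletonClass Ω] (f : Ω → ℝ) :
    ∫ x, f x ∂(uniformOn Set.univ) = (∑ x, f x) / Fintype.card Ω := by
  have hpoint (x : Ω) : (uniformOn (Set.univ : Set Ω)).real {x} = (Fintype.card Ω : ℝ)⁻¹ := by
    simp [measureReal_def, uniformOn_univ]
  rw [integral_fintype (Integrable.of_finite)]
  simp only [hpoint, smul_eq_mul, ← Finset.mul_sum]
  exact inv_mul_eq_div _ _

theorem measureReal_uniformOn_univ_filter {Ω : Type*} [Fintype Ω] [MeasurableSpace Ω]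
    [MeasurableSingletonClass Ω] (p : Ω → Prop) [DecidablePred p] :
    (uniformOn Set.univ).real {x | p x} =
      ((Finset.univ.filter p).card : ℝ) / Fintype.card Ω := by
  rw [← Finset.coe_filter_univ, measureReal_def, uniformOn_univ, Measure.count_apply_finset]
  simp

theorem countBelow_le_of_hasBoundedDifferences {n : ℕ} {H : Assignment n → ℝ} {c : Fin n → ℝ}
    (hH : HasBoundedDifferences H c) (hmean : ∑ z, H z = 0) {s : ℝ} (hs : 0 ≤ s) :
    (countBelow H (-s) : ℝ) ≤ 2 ^ n * Real.exp (-(2 * s ^ 2 / ∑ i, c i ^ 2)) := by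
  have h := hH.measureReal_le_integral_sub_le (fun _ => uniformOn Set.univ)
    (measurable_of_finite H) hs
  rw [← uniformOn_pi, Set.pi_univ, integral_uniformOn_univ, hmean, zero_div, zero_sub,
    measureReal_uniformOn_univ_filter, div_le_iff₀' (by positivity)] at h
  simpa [countBelow] using h

theorem optValue_nonpos_of_sum_eq_zero {n : ℕ} {H : Assignment n → ℝ} (h : ∑ z, H z = 0) :
    optValue H ≤ 0 := by
  obtain ⟨z, -, hz⟩ := Finset.exists_le_of_sum_le (f := H) (g := fun _ => 0) (s := Finset.univ)
    Finset.univ_nonempty (by simp [h])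
  exact (optValue_le H z).trans hz

theorem sum_comp_restrict {ι α : Type*} [Fintype ι] [DecidableEq ι] [Fintype α] (s : Finset ι)
    (g : (s → α) → ℝ) :
    ∑ z : ι → α, g (fun i => z i) =
      (Fintype.card α : ℝ) ^ (Fintype.card ι - s.card) * ∑ w, g w := by
  rw [← (Equiv.piEquivPiSubtypeProd (· ∈ s) fun _ => α).symm.sum_comp, Fintype.sum_prod_type,
    Finset.mul_sum]
  simp [Fintype.card_subtype_compl]

theorem two_rpow_one_sub_mul (γ : ℝ) (n : ℕ) :
    (2 : ℝ) ^ ((1 - γ) * n) = 2 ^ n * Real.exp (-(γ * n * Real.log 2)) := by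
  rw [sub_mul, one_mul, Real.rpow_sub two_pos, Real.rpow_natCast, Real.exp_neg, div_eq_mul_inv,
    Real.rpow_def_of_pos two_pos, mul_comm (Real.log 2)]

end Cube

section ConstraintSatisfaction

variable {n k m : ℕ}

theorem Constraint.card_sat_lt (c : Constraint n k) : c.sat.card < 2 ^ c.vars.card := by
  simpa using Finset.card_lt_card (Finset.ssubset_univ_iff.2 c.sat_ne_univ)

theorem Constraint.numSat_lt (c : Constraint n k) : c.numSat < 2 ^ k := by
  have h := c.card_sat_lt
  calc c.numSat < 2 ^ (k - c.vars.card) * 2 ^ c.vars.card := by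
        rw [Constraint.numSat]
        gcongr
    _ = 2 ^ k := by rw [← pow_add, Nat.sub_add_cancel c.card_vars_le]

theorem Constraint.numSat_add_one_le (c : Constraint n k) : (c.numSat : ℝ) + 1 ≤ 2 ^ k := by
  exact_mod_cast c.numSat_lt

theorem Constraint.abs_value_sub_value_le (c : Constraint n k) (z w : Assignment n) :
    |c.value z - c.value w| ≤ 2 ^ k := by
  have h := c.numSat_add_one_le
  have hs : (0 : ℝ) ≤ c.numSat := Nat.cast_nonneg _
  have hgap : (c.numSat : ℝ) / (2 ^ k - c.numSat) + 1 ≤ 2 ^ k := by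
    rw [div_add_one (by linarith), div_le_iff₀ (by linarith)]
    nlinarith
  have hval : 0 ≤ (c.numSat : ℝ) / (2 ^ k - c.numSat) := div_nonneg hs (by linarith)
  unfold Constraint.value
  split_ifs <;> rw [abs_le] <;> constructor <;> linarith

theorem Constraint.value_update_of_notMem (c : Constraint n k) {i : Fin n} (hi : i ∉ c.vars)
    (z : Assignment n) (a : ℤˣ) : c.value (Function.update z i a) = c.value z := by
  have hrestrict : (fun j : c.vars => Function.update z i a j) = fun j : c.vars => z j :=
    funext fun j => Function.update_of_ne (ne_of_mem_of_not_mem j.2 hi) _ _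
  unfold Constraint.value
  rw [hrestrict]

theorem Constraint.sum_value (c : Constraint n k) : ∑ z, c.value z = 0 := by
  have h := c.numSat_add_one_le
  have hne : (2 : ℝ) ^ k - c.numSat ≠ 0 := by linarith
  have hpow : (2 : ℝ) ^ k = 2 ^ (k - c.vars.card) * 2 ^ c.vars.card := by
    rw [← pow_add, Nat.sub_add_cancel c.card_vars_le]
  have hnumSat : (c.numSat : ℝ) = 2 ^ (k - c.vars.card) * c.sat.card := by
    simp [Constraint.numSat]
  have hcompl : ((c.satᶜ.card : ℕ) : ℝ) = 2 ^ c.vars.card - c.sat.card := by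
    rw [Finset.card_compl, Nat.cast_sub c.sat.card_le_univ]
    simp
  unfold Constraint.value
  rw [sum_comp_restrict c.vars fun w => if w ∈ c.sat then (-1 : ℝ) else _]
  refine mul_eq_zero_of_right _ ?_
  rw [Finset.sum_ite, Finset.sum_const, Finset.sum_const, Finset.filter_univ_mem,
    ← Finset.compl_filter, Finset.filter_univ_mem, nsmul_eq_mul, nsmul_eq_mul, hcompl]
  field_simp
  rw [hpow, hnumSat]
  ring

theorem sum_cspCost (c : Fin m → Constraint n k) : ∑ z, cspCost c z = 0 := by
  simp only [cspCost]
  rw [Finset.sum_comm]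
  exact Finset.sum_eq_zero fun j _ => (c j).sum_value

theorem hasBoundedDifferences_cspCost (c : Fin m → Constraint n k) :
    HasBoundedDifferences (cspCost c) fun i => cspDegree c i * 2 ^ k := by
  intro i z a
  simp only [cspCost, cspDegree]
  rw [← Finset.sum_sub_distrib, ← nsmul_eq_mul, ← Finset.sum_const, Finset.sum_filter]
  refine (Finset.abs_sum_le_sum_abs _ _).trans (Finset.sum_le_sum fun j _ => ?_)
  split_ifs with h
  · exact (c j).abs_value_sub_value_le _ _
  · rw [(c j).value_update_of_notMem h, sub_self, abs_zero]

theorem countBelow_cspCost_le {η : ℝ} (hη : η ≤ 1) (c : Fin m → Constraint n k)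
    (hc : ∀ i, (cspDegree c i : ℝ) ≤ 2 * (k : ℝ) * (m : ℝ) / (n : ℝ)) :
    (countBelow (cspCost c) ((1 - η) * optValue (cspCost c)) : ℝ) ≤
      (2 : ℝ) ^ ((1 - cspGamma k m (optValue (cspCost c)) η) * (n : ℝ)) := by
  have hE := optValue_nonpos_of_sum_eq_zero (sum_cspCost c)
  set E := optValue (cspCost c)
  have hdiff : HasBoundedDifferences (cspCost c) fun _ => 2 * (k : ℝ) * m / n * 2 ^ k :=
    fun i z a => (hasBoundedDifferences_cspCost c i z a).trans
      (mul_le_mul_of_nonneg_right (hc i) (by positivity))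
  have htail := countBelow_le_of_hasBoundedDifferences hdiff (sum_cspCost c)
    (s := (1 - η) * -E) (mul_nonneg (by linarith) (by linarith))
  rw [mul_neg, neg_neg] at htail
  refine htail.trans (le_of_eq ?_)
  have hlog : Real.log 2 ≠ 0 := (Real.log_pos one_lt_two).ne'
  rw [two_rpow_one_sub_mul, cspGamma, div_pow |E|, sq_abs, pow_mul' (2 : ℝ) 2 k, Finset.sum_const,
    Finset.card_univ, Fintype.card_fin, nsmul_eq_mul]
  field_simp

end ConstraintSatisfaction

section Gaussian

theorem exp_neg_le_quadratic {x : ℝ} (hx : 0 ≤ x) : Real.exp (-x) ≤ 1 - x + x ^ 2 / 2 := by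
  have hexp := Real.quadratic_le_exp_of_nonneg hx
  have hnonneg : 0 ≤ 1 - x + x ^ 2 / 2 := by nlinarith [sq_nonneg (x - 1)]
  rw [Real.exp_neg, inv_le_iff_one_le_mul₀ (Real.exp_pos x)]
  calc (1 : ℝ) ≤ (1 - x + x ^ 2 / 2) * (1 + x + x ^ 2 / 2) := by nlinarith [sq_nonneg (x ^ 2)]
    _ ≤ (1 - x + x ^ 2 / 2) * Real.exp x := by gcongr

theorem lintegral_exp_neg_mul_le {Ω : Type*} [MeasurableSpace Ω] {μ : Measure Ω}
    [IsProbabilityMeasure μ] {X : Ω → ℝ} (hX : MemLp X 2 μ) (hX₀ : ∀ ω, 0 ≤ X ω) {l : ℝ}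
    (hl : 0 ≤ l) :
    ∫⁻ ω, ENNReal.ofReal (Real.exp (-(l * X ω))) ∂μ ≤
      ENNReal.ofReal (Real.exp (-(l * μ[X]) + l ^ 2 * μ[X ^ 2] / 2)) := by
  have hle (ω : Ω) : Real.exp (-(l * X ω)) ≤ 1 - l * X ω + l ^ 2 / 2 * X ω ^ 2 :=
    (exp_neg_le_quadratic (mul_nonneg hl (hX₀ ω))).trans (by linarith [mul_pow l (X ω) 2])
  have hlin : Integrable (fun ω => 1 - l * X ω) μ :=
    (integrable_const _).sub ((hX.integrable one_le_two).const_mul _)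
  have hsq : Integrable (fun ω => l ^ 2 / 2 * X ω ^ 2) μ := hX.integrable_sq.const_mul _
  calc ∫⁻ ω, ENNReal.ofReal (Real.exp (-(l * X ω))) ∂μ
      ≤ ∫⁻ ω, ENNReal.ofReal (1 - l * X ω + l ^ 2 / 2 * X ω ^ 2) ∂μ :=
        lintegral_mono fun ω => ENNReal.ofReal_le_ofReal (hle ω)
    _ = ENNReal.ofReal (∫ ω, (1 - l * X ω + l ^ 2 / 2 * X ω ^ 2) ∂μ) :=
        (ofReal_integral_eq_lintegral_ofReal (hlin.add hsq)
          (ae_of_all _ fun ω => (Real.exp_pos _).le.trans (hle ω))).symm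
    _ = ENNReal.ofReal ((-(l * μ[X]) + l ^ 2 * μ[X ^ 2] / 2) + 1) := by
        rw [integral_add hlin hsq, integral_sub (integrable_const _)
          ((hX.integrable one_le_two).const_mul _), integral_const_mul, integral_const_mul]
        simp only [integral_const, probReal_univ, one_smul, Pi.pow_apply]
        ring_nf
    _ ≤ _ := ENNReal.ofReal_le_ofReal (Real.add_one_le_exp _)

theorem integral_mul_exp_neg_mul_sq {b : ℝ} (hb : 0 < b) :
    ∫ x in Set.Ioi (0 : ℝ), x * Real.exp (-b * x ^ 2) = (2 * b)⁻¹ := by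
  have h := integral_rpow_mul_exp_neg_mul_rpow (p := 2) (q := 1) two_pos (by norm_num) hb
  simpa [show (-(1 + 1) / 2 : ℝ) = -1 by norm_num, Real.rpow_neg_one, mul_comm] using h

theorem integral_abs_gaussianReal (v : ℝ≥0) :
    ∫ x, |x| ∂(gaussianReal 0 v) = √(2 / Real.pi) * √v := by
  rcases eq_or_ne v 0 with rfl | hv
  · simp
  have hv₀ : (0 : ℝ) < v := by positivity
  have hdensity (x : ℝ) : gaussianPDFReal 0 v x • |x| =
      (√(2 * Real.pi * v))⁻¹ * (|x| * Real.exp (-(2 * (v : ℝ))⁻¹ * |x| ^ 2)) := by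
    rw [gaussianPDFReal, sub_zero, sq_abs, smul_eq_mul, neg_div, div_eq_inv_mul, neg_mul]
    ring
  rw [integral_gaussianReal_eq_integral_smul hv]
  simp_rw [hdensity]
  rw [integral_const_mul,
    integral_comp_abs (f := fun y => y * Real.exp (-(2 * (v : ℝ))⁻¹ * y ^ 2)),
    integral_mul_exp_neg_mul_sq (by positivity), Real.sqrt_mul (by positivity),
    Real.sqrt_mul two_pos.le, Real.sqrt_div two_pos.le]
  field_simp
  rw [Real.sq_sqrt hv₀.le, Real.sq_sqrt two_pos.le]

theorem lintegral_exp_neg_mul_abs_gaussianReal_le (v : ℝ≥0) {l : ℝ} (hl : 0 ≤ l) :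
    ∫⁻ x, ENNReal.ofReal (Real.exp (-(l * |x|))) ∂(gaussianReal 0 v) ≤
      ENNReal.ofReal (Real.exp (-(l * (√(2 / Real.pi) * √v)) + l ^ 2 * v / 2)) := by
  have hsq : ∫ x, x ^ 2 ∂(gaussianReal 0 v) = v := by
    rw [← variance_of_integral_eq_zero (by fun_prop) (by simp), variance_fun_id_gaussianReal]
  have h := lintegral_exp_neg_mul_le (X := fun x => |x|)
    (memLp_id_gaussianReal' (μ := 0) (v := v) 2 (by simp)).abs abs_nonneg hl
  simpa [integral_abs_gaussianReal, hsq] using h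

theorem map_sum_mul_pi_gaussianReal {ι : Type*} [Fintype ι] (a : ι → ℝ) :
    (Measure.pi fun _ : ι => gaussianReal 0 1).map (fun x => ∑ i, x i * a i) =
      gaussianReal 0 (∑ i, a i ^ 2).toNNReal := by
  set P := Measure.pi fun _ : ι => gaussianReal 0 1
  have hterm (i : ι) : HasLaw (fun x : ι → ℝ => x i * a i) _ P :=
    gaussianReal_mul_const
      ⟨(measurable_pi_apply i).aemeasurable, (measurePreserving_eval _ i).map_eq⟩ (a i)
  have hlaw : HasGaussianLaw (fun x : ι → ℝ => ∑ i, x i * a i) P :=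
    iIndepFun.hasGaussianLaw_fun_sum (fun i => (hterm i).hasGaussianLaw)
      (iIndepFun_pi (X := fun i y => y * a i) fun i => by fun_prop)
  have hmean : P[fun x : ι → ℝ => ∑ i, x i * a i] = 0 := by
    rw [integral_finsetSum _ fun i _ => (hterm i).hasGaussianLaw.integrable]
    simp [(hterm _).integral_eq]
  have hvar : Var[fun x : ι → ℝ => ∑ i, x i * a i; P] = ∑ i, a i ^ 2 := by
    have h := variance_sum_pi (μ := fun _ : ι => gaussianReal 0 1) (X := fun i y => y * a i)
      fun i => (IsGaussian.memLp_two_id).mul_const (a i)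
    rw [← Finset.sum_fn]
    simpa [variance_mul_const] using h
  rw [hlaw.map_eq_gaussianReal, hmean, hvar]

theorem lintegral_exp_neg_mul_abs_sum_pi_gaussianReal_le {ι : Type*} [Fintype ι] (a : ι → ℝ)
    {l : ℝ} (hl : 0 ≤ l) :
    ∫⁻ x, ENNReal.ofReal (Real.exp (-(l * |∑ i, x i * a i|)))
        ∂(Measure.pi fun _ => gaussianReal 0 1) ≤
      ENNReal.ofReal (Real.exp (-(l * (√(2 / Real.pi) * √(∑ i, a i ^ 2))) +
        l ^ 2 * (∑ i, a i ^ 2) / 2)) := by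
  have h := lintegral_exp_neg_mul_abs_gaussianReal_le (∑ i, a i ^ 2).toNNReal hl
  rwa [← map_sum_mul_pi_gaussianReal, lintegral_map (by fun_prop) (by fun_prop),
    Real.coe_toNNReal _ (Finset.sum_nonneg fun i _ => sq_nonneg (a i))] at h

theorem hasSubgaussianMGF_sum_mul_pi_gaussianReal {ι : Type*} [Fintype ι] (a : ι → ℝ) :
    HasSubgaussianMGF (fun x => ∑ i, x i * a i) (∑ i, a i ^ 2).toNNReal
      (Measure.pi fun _ => gaussianReal 0 1) := by
  rw [← HasSubgaussianMGF.id_map_iff (Measurable.aemeasurable (by fun_prop)),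
    map_sum_mul_pi_gaussianReal]
  exact ⟨integrable_exp_mul_gaussianReal, fun t => by simp [mgf_id_gaussianReal]⟩

end Gaussian

section Probability

theorem hasSubgaussianMGF_of_le {Ω : Type*} [MeasurableSpace Ω] {μ : Measure Ω} {X : Ω → ℝ}
    {c d : ℝ≥0} (hX : HasSubgaussianMGF X c μ) (hcd : c ≤ d) : HasSubgaussianMGF X d μ :=
  ⟨hX.integrable_exp_mul, fun t => (hX.mgf_le t).trans (by gcongr)⟩

theorem measureReal_le_exp_of_lintegral_exp_le {Ω : Type*} [MeasurableSpace Ω] {μ : Measure Ω}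
    {X : Ω → ℝ} (hX : Measurable X) {l b : ℝ} (hl : 0 ≤ l)
    (h : ∫⁻ ω, ENNReal.ofReal (Real.exp (l * X ω)) ∂μ ≤ ENNReal.ofReal (Real.exp b)) (a : ℝ) :
    μ.real {ω | a ≤ X ω} ≤ Real.exp (b - l * a) := by
  have hsubset : {ω | a ≤ X ω} ⊆
      {ω | ENNReal.ofReal (Real.exp (l * a)) ≤ ENNReal.ofReal (Real.exp (l * X ω))} :=
    fun ω hω => ENNReal.ofReal_le_ofReal (Real.exp_le_exp.2 (mul_le_mul_of_nonneg_left hω hl))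
  have hmarkov := (mul_meas_ge_le_lintegral (μ := μ) (by fun_prop)
    (ENNReal.ofReal (Real.exp (l * a)))).trans h
  refine ENNReal.toReal_le_of_le_ofReal (Real.exp_pos _).le ((measure_mono hsubset).trans ?_)
  rw [Real.exp_sub, ENNReal.ofReal_div_of_pos (Real.exp_pos _)]
  exact (ENNReal.le_div_iff_mul_le (by simp [Real.exp_pos]) (by simp)).2 (by rwa [mul_comm])

theorem measureReal_le_card_filter_le {Ω ι : Type*} [MeasurableSpace Ω] {μ : Measure Ω}
    [IsFiniteMeasure μ] [Fintype ι] {A : ι → Ω → Prop} [∀ x, DecidablePred fun i => A i x]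
    (hA : ∀ i, MeasurableSet {x | A i x}) {p a : ℝ} (hp : ∀ i, μ.real {x | A i x} ≤ p)
    (ha : 0 < a) :
    μ.real {x | a ≤ ((Finset.univ.filter fun i => A i x).card : ℝ)} ≤ Fintype.card ι * p / a := by
  have hcount (x : Ω) : ((Finset.univ.filter fun i => A i x).card : ℝ) =
      ∑ i, {x | A i x}.indicator (fun _ => (1 : ℝ)) x := by
    simp [Set.indicator_apply]
  have hint (i : ι) : Integrable ({x | A i x}.indicator (fun _ => (1 : ℝ))) μ :=
    (integrable_const _).indicator (hA i)
  simp_rw [hcount]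
  rw [le_div_iff₀' ha]
  calc a * μ.real {x | a ≤ ∑ i, {x | A i x}.indicator (fun _ => (1 : ℝ)) x}
      ≤ ∫ x, ∑ i, {x | A i x}.indicator (fun _ => (1 : ℝ)) x ∂μ :=
        mul_meas_ge_le_integral_of_nonneg
          (ae_of_all _ fun x => Finset.sum_nonneg fun i _ =>
            Set.indicator_nonneg (fun _ _ => zero_le_one) x)
          (integrable_finsetSum _ fun i _ => hint i) a
    _ = ∑ i, μ.real {x | A i x} := by
        simp [integral_finsetSum _ fun i _ => hint i, integral_indicator_const _ (hA _)]
    _ ≤ Fintype.card ι * p := by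
        simpa using Finset.sum_le_sum fun i (_ : i ∈ Finset.univ) => hp i

end Probability

section SpinProducts

variable {n : ℕ} {S : Finset (Fin n)} {i : Fin n}

/-- The monomial `∏_{i ∈ S} z_i` of the spins, with real values. -/
def spinProd (S : Finset (Fin n)) (z : Assignment n) : ℝ :=
  ∏ i ∈ S, ((z i : ℤ) : ℝ)

theorem spinProd_sq (S : Finset (Fin n)) (z : Assignment n) : spinProd S z ^ 2 = 1 := by
  rw [spinProd, ← Finset.prod_pow]
  exact Finset.prod_eq_one fun i _ => by exact_mod_cast Int.units_coe_mul_self (z i) ▸ sq _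

theorem spinProd_update_of_notMem (hi : i ∉ S) (z : Assignment n) (a : ℤˣ) :
    spinProd S (Function.update z i a) = spinProd S z :=
  Finset.prod_congr rfl fun j hj => by rw [Function.update_of_ne (ne_of_mem_of_not_mem hj hi)]

theorem spinProd_update_neg_of_mem (hi : i ∈ S) (z : Assignment n) :
    spinProd S (Function.update z i (-z i)) = -spinProd S z := by
  have herase := spinProd_update_of_notMem (Finset.notMem_erase i S) z (-z i)
  unfold spinProd at herase ⊢
  rw [← Finset.mul_prod_erase _ _ hi, herase,
    ← Finset.mul_prod_erase _ (fun j => ((z j : ℤ) : ℝ)) hi]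
  simp

end SpinProducts

section PartialCost

variable {n k : ℕ}

/-- The `k`-element sets of spins all of whose elements are smaller than `t`: their couplings are
the ones revealed once the first `t` spins have been chosen. -/
def setsBelow (n k t : ℕ) : Finset {S : Finset (Fin n) // S.card = k} :=
  Finset.univ.filter fun S => ∀ i ∈ S.1, (i : ℕ) < t

theorem card_setsBelow {t : ℕ} (ht : t ≤ n) : (setsBelow n k t).card = t.choose k := by
  have hcard : (Finset.univ.filter fun i : Fin n => (i : ℕ) < t).card = t := by
    rw [Fin.card_filter_val_lt, min_eq_right ht]
  have hmap : (setsBelow n k t).map (Function.Embedding.subtype _) =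
      (Finset.univ.filter fun i : Fin n => (i : ℕ) < t).powersetCard k := by
    ext S
    simp [setsBelow, Finset.mem_powersetCard, Finset.subset_iff, and_comm]
  rw [← Finset.card_map, hmap, Finset.card_powersetCard, hcard]

theorem setsBelow_zero : setsBelow n (k + 1) 0 = ∅ := by
  rw [← Finset.card_eq_zero, card_setsBelow n.zero_le, Nat.choose_zero_succ]

theorem setsBelow_self : setsBelow n k n = Finset.univ := by
  simp [setsBelow]

theorem filter_notMem_setsBelow_succ (i : Fin n) :
    (setsBelow n k (i + 1)).filter (i ∉ ·.1) = setsBelow n k i := by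
  ext S
  simp only [setsBelow, Finset.mem_filter, Finset.mem_univ, true_and]
  constructor
  · rintro ⟨hS, hi⟩ j hj
    exact (Nat.lt_succ_iff.1 (hS j hj)).lt_of_ne (Fin.val_ne_of_ne (ne_of_mem_of_not_mem hj hi))
  · exact fun hS => ⟨fun j hj => (hS j hj).trans (Nat.lt_succ_self _), fun hi => (hS i hi).false⟩

theorem card_filter_mem_setsBelow_succ (i : Fin n) :
    ((setsBelow n (k + 1) (i + 1)).filter (i ∈ ·.1)).card = (i : ℕ).choose k := by
  have h := Finset.card_filter_add_card_filter_not (s := setsBelow n (k + 1) (i + 1)) (i ∈ ·.1)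
  rw [filter_notMem_setsBelow_succ, card_setsBelow i.2.le, card_setsBelow i.2,
    Nat.choose_succ_succ'] at h
  omega

/-- The part of the `k`-spin cost function that comes from the couplings in `A`, without the
normalisation. -/
def partialCost (A : Finset {S : Finset (Fin n) // S.card = k}) (J : Couplings n k)
    (z : Assignment n) : ℝ :=
  ∑ S ∈ A, J S * spinProd S.1 z

theorem measurable_partialCost (A : Finset {S : Finset (Fin n) // S.card = k})
    (z : Assignment n) : Measurable fun J => partialCost A J z := by
  unfold partialCost
  fun_prop

theorem optValue_partialCost_le_sub_abs (A : Finset {S : Finset (Fin n) // S.card = k})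
    (i : Fin n) (J : Couplings n k) (y : Assignment n) :
    optValue (partialCost A J) ≤
      partialCost (A.filter (i ∉ ·.1)) J y - |partialCost (A.filter (i ∈ ·.1)) J y| := by
  have hsplit (z : Assignment n) : partialCost (A.filter (i ∈ ·.1)) J z +
      partialCost (A.filter (i ∉ ·.1)) J z = partialCost A J z :=
    Finset.sum_filter_add_sum_filter_not _ _ _
  have hflip : partialCost (A.filter (i ∈ ·.1)) J (Function.update y i (-y i)) =
      -partialCost (A.filter (i ∈ ·.1)) J y := by
    simp only [partialCost, ← Finset.sum_neg_distrib]
    exact Finset.sum_congr rfl fun S hS => by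
      rw [spinProd_update_neg_of_mem (Finset.mem_filter.1 hS).2, mul_neg]
  have hfix : partialCost (A.filter (i ∉ ·.1)) J (Function.update y i (-y i)) =
      partialCost (A.filter (i ∉ ·.1)) J y :=
    Finset.sum_congr rfl fun S hS => by
      rw [spinProd_update_of_notMem (Finset.mem_filter.1 hS).2]
  have hy := optValue_le (partialCost A J) y
  have hyflip := optValue_le (partialCost A J) (Function.update y i (-y i))
  rw [← hsplit] at hy hyflip
  rcases abs_cases (partialCost (A.filter (i ∈ ·.1)) J y) with ⟨h, -⟩ | ⟨h, -⟩ <;> linarith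

theorem partialCost_updateFinset_of_disjoint {A B : Finset {S : Finset (Fin n) // S.card = k}}
    (h : Disjoint A B) (J : Couplings n k) (w : B → ℝ) :
    partialCost A (Function.updateFinset J B w) = partialCost A J :=
  funext fun z => Finset.sum_congr rfl fun S hS => by
    rw [Function.updateFinset, dif_neg (Finset.disjoint_left.1 h hS)]

theorem partialCost_updateFinset_self {B : Finset {S : Finset (Fin n) // S.card = k}}
    (J : Couplings n k) (w : B → ℝ) (z : Assignment n) :
    partialCost B (Function.updateFinset J B w) z = ∑ S, w S * spinProd S.1.1 z := by
  rw [partialCost, ← Finset.sum_coe_sort]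
  exact Finset.sum_congr rfl fun S _ => by rw [Function.updateFinset, dif_pos S.2]

end PartialCost

section GreedyEnergy

variable {n k : ℕ}

instance isProbabilityMeasure_kSpinLaw (n k : ℕ) : IsProbabilityMeasure (kSpinLaw n k) := by
  unfold kSpinLaw
  infer_instance

theorem lintegral_exp_optValue_partialCost_le (A : Finset {S : Finset (Fin n) // S.card = k})
    (i : Fin n) {l : ℝ} (hl : 0 ≤ l) :
    ∫⁻ J, ENNReal.ofReal (Real.exp (l * optValue (partialCost A J))) ∂(kSpinLaw n k) ≤
      (∫⁻ J, ENNReal.ofReal (Real.exp (l * optValue (partialCost (A.filter (i ∉ ·.1)) J)))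
        ∂(kSpinLaw n k)) *
      ENNReal.ofReal (Real.exp (-(l * (√(2 / Real.pi) * √(A.filter (i ∈ ·.1)).card)) +
        l ^ 2 * (A.filter (i ∈ ·.1)).card / 2)) := by
  set B := A.filter (i ∈ ·.1)
  set A' := A.filter (i ∉ ·.1)
  have hdisj : Disjoint A' B := (Finset.disjoint_filter_filter_not A A _).symm
  have hmeas (D : Finset {S : Finset (Fin n) // S.card = k}) : Measurable fun J =>
      ENNReal.ofReal (Real.exp (l * optValue (partialCost D J))) :=
    ((measurable_optValue (measurable_partialCost D)).const_mul l).exp.ennreal_ofReal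
  rw [← lintegral_mul_const _ (hmeas A')]
  refine lintegral_le_of_lmarginal_le B (hmeas A) ((hmeas A').mul_const _) fun J => ?_
  obtain ⟨y, hy⟩ := exists_eq_optValue (partialCost A' J)
  have hgreedy (w : B → ℝ) : optValue (partialCost A (Function.updateFinset J B w)) ≤
      optValue (partialCost A' J) - |∑ S, w S * spinProd S.1.1 y| := by
    have h := optValue_partialCost_le_sub_abs A i (Function.updateFinset J B w) y
    rwa [partialCost_updateFinset_of_disjoint hdisj, partialCost_updateFinset_self, hy] at h
  have hexp := lintegral_exp_neg_mul_abs_sum_pi_gaussianReal_le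
    (fun S : B => spinProd S.1.1 y) hl
  simp only [spinProd_sq, Finset.sum_const, Finset.card_univ, Fintype.card_coe, nsmul_one] at hexp
  simp only [lmarginal, partialCost_updateFinset_of_disjoint hdisj, lintegral_const, measure_univ,
    mul_one]
  refine le_trans ?_ (mul_le_mul_right hexp _)
  rw [← lintegral_const_mul _ (by fun_prop)]
  refine lintegral_mono fun w => ?_
  rw [← ENNReal.ofReal_mul (Real.exp_pos _).le, ← Real.exp_add, ← mul_neg, ← mul_add]
  exact ENNReal.ofReal_le_ofReal (Real.exp_le_exp.2 (mul_le_mul_of_nonneg_left (hgreedy w) hl))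

theorem lintegral_exp_optValue_setsBelow_le {l : ℝ} (hl : 0 ≤ l) {t : ℕ} (ht : t ≤ n) :
    ∫⁻ J, ENNReal.ofReal (Real.exp (l * optValue (partialCost (setsBelow n (k + 1) t) J)))
        ∂(kSpinLaw n (k + 1)) ≤
      ENNReal.ofReal (Real.exp (∑ s ∈ Finset.range t,
        (-(l * (√(2 / Real.pi) * √(s.choose k))) + l ^ 2 * s.choose k / 2))) := by
  induction t with
  | zero =>
    have hzero (J : Couplings n (k + 1)) : optValue (partialCost ∅ J) = 0 :=
      (exists_eq_optValue _).elim fun z hz => hz ▸ Finset.sum_empty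
    simp [setsBelow_zero, hzero]
  | succ t ih =>
    have hstep := lintegral_exp_optValue_partialCost_le (setsBelow n (k + 1) (t + 1)) ⟨t, ht⟩ hl
    rw [filter_notMem_setsBelow_succ ⟨t, ht⟩, card_filter_mem_setsBelow_succ ⟨t, ht⟩] at hstep
    rw [Finset.sum_range_succ, Real.exp_add (Finset.sum _ _),
      ENNReal.ofReal_mul (Real.exp_pos _).le]
    exact hstep.trans (mul_le_mul_left (ih (Nat.le_of_succ_le ht)) _)

end GreedyEnergy

section Normalization

variable {n k s : ℕ}

/-- The normalisation `sqrt (k! / n^(k-1))` of the `k`-spin model. -/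
def kSpinScale (n k : ℕ) : ℝ := √(k.factorial / n ^ (k - 1))

theorem kSpinScale_nonneg (n k : ℕ) : 0 ≤ kSpinScale n k := Real.sqrt_nonneg _

theorem kSpinScale_sq (n k : ℕ) : kSpinScale n k ^ 2 = k.factorial / n ^ (k - 1) :=
  Real.sq_sqrt (by positivity)

theorem kSpinScale_sq_mul_choose (n k : ℕ) :
    kSpinScale n k ^ 2 * n.choose k = n.descFactorial k / n ^ (k - 1) := by
  rw [kSpinScale_sq, Nat.descFactorial_eq_factorial_mul_choose, Nat.cast_mul, div_mul_eq_mul_div]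

theorem kSpinScale_sq_mul_choose_le (n k : ℕ) :
    kSpinScale n (k + 1) ^ 2 * n.choose (k + 1) ≤ n := by
  rcases n.eq_zero_or_pos with rfl | hn
  · simp
  rw [kSpinScale_sq_mul_choose, div_le_iff₀ (by positivity), Nat.add_sub_cancel, ← pow_succ']
  exact_mod_cast Nat.descFactorial_le_pow n (k + 1)

theorem half_mul_pow_le_descFactorial (h : 2 * (k + 1) ^ 2 ≤ n) :
    (n : ℝ) ^ (k + 1) / 2 ≤ n.descFactorial (k + 1) := by
  have hkn : k ≤ n := by nlinarith
  have hn : (0 : ℝ) < n := by exact_mod_cast (by positivity : 0 < 2 * (k + 1) ^ 2).trans_le h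
  have hfrac : (k : ℝ) / n ≤ 1 := (div_le_one hn).2 (by exact_mod_cast hkn)
  have hsmall : ((k + 1 : ℕ) : ℝ) * (k / n) ≤ 1 / 2 := by
    rw [← mul_div_assoc, div_le_iff₀ hn]
    have h' : 2 * ((k : ℝ) + 1) ^ 2 ≤ n := by exact_mod_cast h
    push_cast
    nlinarith [Nat.cast_nonneg (α := ℝ) k]
  have hbernoulli := one_add_mul_le_pow (a := -((k : ℝ) / n)) (by linarith) (k + 1)
  calc (n : ℝ) ^ (k + 1) / 2 = n ^ (k + 1) * (1 / 2) := by ring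
    _ ≤ n ^ (k + 1) * (1 + -((k : ℝ) / n)) ^ (k + 1) := by
        gcongr
        linarith
    _ = ((n + 1 - (k + 1) : ℕ) : ℝ) ^ (k + 1) := by
        rw [← mul_pow, Nat.add_sub_add_right, Nat.cast_sub hkn]
        congr 1
        field_simp
        ring
    _ ≤ n.descFactorial (k + 1) := by exact_mod_cast Nat.pow_sub_le_descFactorial n (k + 1)

theorem half_le_kSpinScale_sq_mul_choose (h : 2 * (k + 1) ^ 2 ≤ n) :
    (n : ℝ) / 2 ≤ kSpinScale n (k + 1) ^ 2 * n.choose (k + 1) := by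
  have hn : 0 < n := (by positivity : 0 < 2 * (k + 1) ^ 2).trans_le h
  rw [kSpinScale_sq_mul_choose, le_div_iff₀ (by positivity), Nat.add_sub_cancel,
    div_mul_eq_mul_div, ← pow_succ']
  exact half_mul_pow_le_descFactorial h

theorem kSpinScale_mul_sqrt_choose_sq (n k s : ℕ) :
    (kSpinScale n (k + 1) * √(s.choose k)) ^ 2 = kSpinScale n (k + 1) ^ 2 * s.choose k := by
  rw [mul_pow, Real.sq_sqrt (Nat.cast_nonneg _)]

theorem kSpinScale_mul_sqrt_choose_le (hs : s < n) (k : ℕ) :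
    kSpinScale n (k + 1) * √(s.choose k) ≤ k + 1 := by
  have hn : (0 : ℝ) < n := by exact_mod_cast s.zero_le.trans_lt hs
  have hchoose : (s.choose k : ℝ) ≤ n ^ k / k.factorial :=
    (Nat.choose_le_pow_div k s).trans (by gcongr)
  refine (abs_le_of_sq_le_sq' ?_ (by positivity)).2
  rw [kSpinScale_mul_sqrt_choose_sq, kSpinScale_sq, Nat.add_sub_cancel]
  calc ((k + 1).factorial : ℝ) / n ^ k * s.choose k
      ≤ (k + 1).factorial / n ^ k * (n ^ k / k.factorial) := by gcongr
    _ = k + 1 := by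
        rw [Nat.factorial_succ]
        push_cast
        field_simp
    _ ≤ (k + 1) ^ 2 := le_self_pow₀ (by simp) two_ne_zero

theorem sum_range_choose_eq_choose_succ (n k : ℕ) :
    ∑ s ∈ Finset.range n, s.choose k = n.choose (k + 1) := by
  induction n with
  | zero => simp
  | succ n ih => rw [Finset.sum_range_succ, ih, Nat.choose_succ_succ', add_comm]

theorem sum_kSpinScale_sq_mul_choose (n k : ℕ) :
    ∑ s ∈ Finset.range n, kSpinScale n (k + 1) ^ 2 * s.choose k =
      kSpinScale n (k + 1) ^ 2 * n.choose (k + 1) := by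
  rw [← Finset.mul_sum, ← Nat.cast_sum, sum_range_choose_eq_choose_succ]

theorem le_sum_kSpinScale_mul_sqrt_choose (h : 2 * (k + 1) ^ 2 ≤ n) :
    (n : ℝ) / (2 * (k + 1)) ≤ ∑ s ∈ Finset.range n, kSpinScale n (k + 1) * √(s.choose k) := by
  rw [← div_div, div_le_iff₀ (by positivity), Finset.sum_mul]
  calc (n : ℝ) / 2 ≤ kSpinScale n (k + 1) ^ 2 * n.choose (k + 1) :=
        half_le_kSpinScale_sq_mul_choose h
    _ = ∑ s ∈ Finset.range n, (kSpinScale n (k + 1) * √(s.choose k)) ^ 2 := by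
        simp_rw [← sum_kSpinScale_sq_mul_choose, kSpinScale_mul_sqrt_choose_sq]
    _ ≤ ∑ s ∈ Finset.range n, kSpinScale n (k + 1) * √(s.choose k) * (k + 1) := by
        refine Finset.sum_le_sum fun s hs => ?_
        rw [sq]
        exact mul_le_mul_of_nonneg_left (kSpinScale_mul_sqrt_choose_le (Finset.mem_range.1 hs) k)
          (mul_nonneg (kSpinScale_nonneg _ _) (Real.sqrt_nonneg _))

end Normalization

section SpinGlass

variable {n k : ℕ}

theorem kSpinCost_eq_kSpinScale_mul (J : Couplings n k) :
    kSpinCost J = fun z => kSpinScale n k * partialCost (setsBelow n k n) J z := by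
  rw [setsBelow_self]
  rfl

theorem measurable_kSpinCost (z : Assignment n) :
    Measurable fun J : Couplings n k => kSpinCost J z := by
  unfold kSpinCost
  fun_prop

theorem hasSubgaussianMGF_kSpinCost (n k : ℕ) (z : Assignment n) :
    HasSubgaussianMGF (fun J => kSpinCost J z) n (kSpinLaw n (k + 1)) := by
  have hsum := hasSubgaussianMGF_sum_mul_pi_gaussianReal
    fun S : {S : Finset (Fin n) // S.card = k + 1} => kSpinScale n (k + 1) * spinProd S.1 z
  have hcost : (fun J : Couplings n (k + 1) => kSpinCost J z) =
      fun J => ∑ S, J S * (kSpinScale n (k + 1) * spinProd S.1 z) := by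
    funext J
    simp only [kSpinCost_eq_kSpinScale_mul, setsBelow_self, partialCost, Finset.mul_sum,
      mul_left_comm]
  rw [hcost]
  refine hasSubgaussianMGF_of_le hsum (Real.toNNReal_le_iff_le_coe.2 ?_)
  simpa [mul_pow, spinProd_sq, mul_comm] using kSpinScale_sq_mul_choose_le n k

theorem measureReal_kSpinCost_le_neg_le (n k : ℕ) (z : Assignment n) {s : ℝ} (hs : 0 ≤ s) :
    (kSpinLaw n (k + 1)).real {J | kSpinCost J z ≤ -s} ≤ Real.exp (-(s ^ 2 / (2 * n))) := by
  simpa [le_neg, neg_div] using (hasSubgaussianMGF_kSpinCost n k z).neg.measure_ge_le hs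

theorem measureReal_le_countBelow_kSpinCost_le (n k : ℕ) {s a : ℝ} (hs : 0 ≤ s) (ha : 0 < a) :
    (kSpinLaw n (k + 1)).real {J | a ≤ countBelow (kSpinCost J) (-s)} ≤
      2 ^ n * Real.exp (-(s ^ 2 / (2 * n))) / a := by
  simpa [countBelow] using measureReal_le_card_filter_le
    (fun z => measurableSet_le (measurable_kSpinCost z) measurable_const)
    (fun z => measureReal_kSpinCost_le_neg_le n k z hs) ha

theorem lintegral_exp_optValue_kSpinCost_le (n k : ℕ) {l : ℝ} (hl : 0 ≤ l) :
    ∫⁻ J, ENNReal.ofReal (Real.exp (l * optValue (kSpinCost J))) ∂(kSpinLaw n (k + 1)) ≤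
      ENNReal.ofReal (Real.exp (-(l * (√(2 / Real.pi) *
        ∑ s ∈ Finset.range n, kSpinScale n (k + 1) * √(s.choose k))) + l ^ 2 * n / 2)) := by
  have hopt (J : Couplings n (k + 1)) : l * optValue (kSpinCost J) =
      l * kSpinScale n (k + 1) * optValue (partialCost (setsBelow n (k + 1) n) J) := by
    rw [kSpinCost_eq_kSpinScale_mul, optValue_const_mul (kSpinScale_nonneg _ _), mul_assoc]
  simp_rw [hopt]
  refine (lintegral_exp_optValue_setsBelow_le (mul_nonneg hl (kSpinScale_nonneg _ _)) le_rfl).trans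
    (ENNReal.ofReal_le_ofReal (Real.exp_le_exp.2 ?_))
  rw [Finset.sum_add_distrib, Finset.sum_neg_distrib]
  refine add_le_add (le_of_eq ?_) ?_
  · simp only [Finset.mul_sum]
    exact congrArg _ (Finset.sum_congr rfl fun s _ => by ring)
  · simp_rw [mul_pow, mul_assoc (l ^ 2), ← Finset.sum_div, ← Finset.mul_sum]
    rw [Finset.mul_sum, sum_kSpinScale_sq_mul_choose]
    gcongr
    exact kSpinScale_sq_mul_choose_le n k

/-- The lower bound, for `2 k^2 ≤ n`, for `-E[E^*]` in the `k`-spin model that is obtained by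
choosing the spins one after the other, each with the sign that lowers the energy; `√(2 / π)` is the
mean absolute value of a standard Gaussian. -/
def greedyEnergy (n k : ℕ) : ℝ := √(2 / Real.pi) * (n / (2 * k))

theorem greedyEnergy_nonneg (n k : ℕ) : 0 ≤ greedyEnergy n k := by
  unfold greedyEnergy
  positivity

theorem greedyEnergy_le (h : 2 * (k + 1) ^ 2 ≤ n) :
    greedyEnergy n (k + 1) ≤
      √(2 / Real.pi) * ∑ s ∈ Finset.range n, kSpinScale n (k + 1) * √(s.choose k) := by
  rw [greedyEnergy, Nat.cast_add_one]
  gcongr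
  exact le_sum_kSpinScale_mul_sqrt_choose h

theorem measureReal_neg_half_greedyEnergy_le_optValue_le (h : 2 * (k + 1) ^ 2 ≤ n) :
    (kSpinLaw n (k + 1)).real {J | -(greedyEnergy n (k + 1) / 2) ≤ optValue (kSpinCost J)} ≤
      Real.exp (-(greedyEnergy n (k + 1) ^ 2 / (8 * n))) := by
  have hn : (0 : ℝ) < n := by exact_mod_cast (by positivity : 0 < 2 * (k + 1) ^ 2).trans_le h
  have hG := greedyEnergy_nonneg n (k + 1)
  have hGS := greedyEnergy_le h
  set G := greedyEnergy n (k + 1)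
  have hl : 0 ≤ G / (2 * n) := by positivity
  refine (measureReal_le_exp_of_lintegral_exp_le (measurable_optValue measurable_kSpinCost) hl
    (lintegral_exp_optValue_kSpinCost_le n k hl) _).trans (Real.exp_le_exp.2 ?_)
  have hlGS := mul_le_mul_of_nonneg_left hGS hl
  have hopt : G / (2 * n) * G - (G / (2 * n)) ^ 2 * n / 2 - G / (2 * n) * (G / 2) =
      G ^ 2 / (8 * n) := by
    field_simp
    norm_num
  linarith

theorem kSpinGamma_mul_eq (hn : 0 < n) (k : ℕ) (η : ℝ) :
    kSpinGamma k η * n * Real.log 2 = (1 - η) ^ 2 * greedyEnergy n k ^ 2 / (16 * n) := by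
  have hlog : Real.log 2 ≠ 0 := (Real.log_pos one_lt_two).ne'
  rw [kSpinGamma, greedyEnergy, mul_pow, Real.sq_sqrt (by positivity)]
  field_simp
  ring

theorem two_mul_sq_le_of_one_lt_kSpinGamma_mul {η : ℝ} (hη₀ : 0 ≤ η) (hη₁ : η ≤ 1)
    (h : 1 < kSpinGamma (k + 1) η * n) : 2 * (k + 1) ^ 2 ≤ n := by
  have hlog : (0.5 : ℝ) < Real.log 2 := by linarith [Real.log_two_gt_d9]
  have hconst : 2 ≤ 32 * Real.pi * Real.log 2 := by nlinarith [Real.pi_gt_three]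
  rw [kSpinGamma, div_mul_eq_mul_div, Nat.cast_add_one, lt_div_iff₀ (by positivity), one_mul] at h
  have hn : (1 - η) ^ 2 * n ≤ n :=
    mul_le_of_le_one_left n.cast_nonneg (pow_le_one₀ (by linarith) (by linarith))
  have hk : 2 * ((k : ℝ) + 1) ^ 2 ≤ 32 * Real.pi * Real.log 2 * (k + 1) ^ 2 := by gcongr
  exact_mod_cast hk.trans (h.le.trans hn)

theorem measureReal_lt_countBelow_le (μ : Measure (Couplings n k)) [IsFiniteMeasure μ] {η b a : ℝ}
    (hη : η ≤ 1) :
    μ.real {J | a < countBelow (kSpinCost J) ((1 - η) * optValue (kSpinCost J))} ≤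
      μ.real {J | -b ≤ optValue (kSpinCost J)} +
        μ.real {J | a ≤ countBelow (kSpinCost J) (-((1 - η) * b))} := by
  refine (measureReal_mono fun J hJ => ?_).trans (measureReal_union_le _ _)
  rcases le_total (-b) (optValue (kSpinCost J)) with hb | hb
  · exact Or.inl hb
  · have hE : (1 - η) * optValue (kSpinCost J) ≤ -((1 - η) * b) := by
      rw [← mul_neg]
      exact mul_le_mul_of_nonneg_left hb (by linarith)
    have hcount : a ≤ countBelow (kSpinCost J) (-((1 - η) * b)) :=
      (le_of_lt hJ).trans (Nat.cast_le.2 (countBelow_mono _ hE))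
    exact Or.inr hcount

theorem measureReal_two_rpow_lt_countBelow_kSpinCost_le {η : ℝ} (hη₀ : 0 ≤ η) (hη₁ : η ≤ 1)
    (h : 2 * (k + 1) ^ 2 ≤ n) :
    (kSpinLaw n (k + 1)).real
        {J | (2 : ℝ) ^ ((1 - kSpinGamma (k + 1) η) * n) <
          countBelow (kSpinCost J) ((1 - η) * optValue (kSpinCost J))} ≤
      2 * Real.exp (-(kSpinGamma (k + 1) η * n * Real.log 2)) := by
  have hn : 0 < n := (by positivity : 0 < 2 * (k + 1) ^ 2).trans_le h
  have hγ := kSpinGamma_mul_eq hn (k + 1) η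
  have hopt := measureReal_neg_half_greedyEnergy_le_optValue_le h
  have hcount := measureReal_le_countBelow_kSpinCost_le n k
    (s := (1 - η) * (greedyEnergy n (k + 1) / 2))
    (mul_nonneg (by linarith) (by linarith [greedyEnergy_nonneg n (k + 1)]))
    (Real.rpow_pos_of_pos two_pos ((1 - kSpinGamma (k + 1) η) * n))
  set G := greedyEnergy n (k + 1)
  set q := Real.exp (-(kSpinGamma (k + 1) η * n * Real.log 2)) with hq
  refine (measureReal_lt_countBelow_le _ hη₁ (b := G / 2)).trans ?_
  rw [two_mul]
  refine add_le_add (hopt.trans (Real.exp_le_exp.2 (neg_le_neg ?_))) (hcount.trans (le_of_eq ?_))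
  · rw [hγ]
    have hsq : (1 - η) ^ 2 ≤ 1 := pow_le_one₀ (by linarith) (by linarith)
    gcongr
    · nlinarith [sq_nonneg G]
    · norm_num
  · have hexp : ((1 - η) * (G / 2)) ^ 2 / (2 * n) =
        2 * (kSpinGamma (k + 1) η * n * Real.log 2) := by
      rw [hγ]
      field_simp
      norm_num
    rw [hexp, ← mul_neg, two_mul (-_ : ℝ), Real.exp_add, two_rpow_one_sub_mul, ← hq]
    field_simp

theorem kSpin_countBelow_le {η : ℝ} (hη₀ : 0 ≤ η) (hη₁ : η ≤ 1) :
    1 - (2 : ℝ) ^ (-(kSpinGamma (k + 1) η) * (n : ℝ) + 1) ≤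
      (kSpinLaw n (k + 1)).real
        {J | (countBelow (kSpinCost J) ((1 - η) * optValue (kSpinCost J)) : ℝ) ≤
          (2 : ℝ) ^ ((1 - kSpinGamma (k + 1) η) * (n : ℝ))} := by
  rcases le_or_gt (kSpinGamma (k + 1) η * n) 1 with hsmall | hlarge
  · have hone : (1 : ℝ) ≤ 2 ^ (-(kSpinGamma (k + 1) η) * (n : ℝ) + 1) :=
      Real.one_le_rpow one_le_two (by linarith)
    exact (sub_nonpos.2 hone).trans measureReal_nonneg
  have hfail := measureReal_two_rpow_lt_countBelow_kSpinCost_le hη₀ hη₁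
    (two_mul_sq_le_of_one_lt_kSpinGamma_mul hη₀ hη₁ hlarge)
  set a := (2 : ℝ) ^ ((1 - kSpinGamma (k + 1) η) * (n : ℝ))
  have hcover : 1 ≤
      (kSpinLaw n (k + 1)).real
          {J | countBelow (kSpinCost J) ((1 - η) * optValue (kSpinCost J)) ≤ a} +
        (kSpinLaw n (k + 1)).real
          {J | a < countBelow (kSpinCost J) ((1 - η) * optValue (kSpinCost J))} := by
    rw [← probReal_univ (μ := kSpinLaw n (k + 1))]
    exact (measureReal_mono fun J _ => le_or_gt _ a).trans (measureReal_union_le _ _)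
  have hexp : (2 : ℝ) ^ (-(kSpinGamma (k + 1) η) * (n : ℝ) + 1) =
      2 * Real.exp (-(kSpinGamma (k + 1) η * n * Real.log 2)) := by
    rw [Real.rpow_add_one two_ne_zero, Real.rpow_def_of_pos two_pos]
    ring_nf
  linarith

end SpinGlass

end TailBound

end

theorem mainTheorem9 (n k : ℕ) (hn : 1 ≤ n) (hk : 1 ≤ k) (η : ℝ) (hη₀ : 0 ≤ η) (hη₁ : η ≤ 1) :
    (∀ (m : ℕ), 1 ≤ m → ∀ c : Fin m → TailBound.Constraint n k,
      (∀ i : Fin n, (TailBound.cspDegree c i : ℝ) ≤ 2 * (k : ℝ) * (m : ℝ) / (n : ℝ)) →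
      (TailBound.countBelow (TailBound.cspCost c)
          ((1 - η) * TailBound.optValue (TailBound.cspCost c)) : ℝ) ≤
        (2 : ℝ) ^ ((1 - TailBound.cspGamma k m (TailBound.optValue (TailBound.cspCost c)) η) *
          (n : ℝ))) ∧
    (1 - (2 : ℝ) ^ (-(TailBound.kSpinGamma k η) * (n : ℝ) + 1) ≤
      (TailBound.kSpinLaw n k).real
        {J | (TailBound.countBelow (TailBound.kSpinCost J)
            ((1 - η) * TailBound.optValue (TailBound.kSpinCost J)) : ℝ) ≤
          (2 : ℝ) ^ ((1 - TailBound.kSpinGamma k η) * (n : ℝ))}) := by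
  refine ⟨fun m _ c hc => TailBound.countBelow_cspCost_le hη₁ c hc, ?_⟩
  obtain ⟨k, rfl⟩ := Nat.exists_eq_add_of_le' hk
  exact TailBound.kSpin_countBelow_le hη₀ hη₁
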